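/- For non-negative integers $l,m,n$ let $T_{l,m,n}$ be the starlike tree obtained from a single central vertex and three disjoint paths $P_l,P_m,P_n$ (on $l,m,n$ vertices respectively) by joining one end vertex of each path to the central vertex by an edge. For a finite simple graph $G$ let $\mu(G)$ be its Laplacian spectral radius, that is, the largest eigenvalue of the Laplacian matrix $L(G)=D(G)-A(G)$, where $D(G)$ is the diagonal matrix of vertex degrees and $A(G)$ the adjacency matrix. Theorem. The polynomial $x^3-4x-4$ has exactly one real root $\epsilon$, one has $2+\epsilon\approx 4.382975767$ (with an error less than $10^{-9}$), and $$\lim_{n\to\infty}\mu(T_{1,n,n}) = 2+\epsilon .$$ -/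

import Mathlib

/-- The vertices of `T_{l,m,n}`: the centre `none`, and `some ⟨i, j⟩`, the vertex number `j`
(counted from the centre, starting at `0`) of the `i`-th arm, where the three arms have
`l`, `m` and `n` vertices. -/
abbrev TVertex (l m n : ℕ) : Type := Option (Σ i : Fin 3, Fin (![l, m, n] i))

/-- `TNext u v`: the vertex `v` comes directly after `u` on the way from the centre to the end
of an arm. -/
def TNext {l m n : ℕ} : TVertex l m n → TVertex l m n → Prop
  | none, some ⟨_, j⟩ => (j : ℕ) = 0
  | some ⟨i, j⟩, some ⟨i', j'⟩ => i = i' ∧ (j' : ℕ) = (j : ℕ) + 1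
  | _, none => False

/-- The starlike tree `T_{l,m,n}`: a centre with three disjoint paths on `l`, `m` and `n` vertices
attached to it by an end vertex of each. -/
def TGraph (l m n : ℕ) : SimpleGraph (TVertex l m n) :=
  SimpleGraph.fromRel TNext

open Classical in
/-- The Laplacian spectral radius of a finite graph: the largest eigenvalue of its Laplacian
matrix `D - A`. -/
noncomputable def lapSpectralRadius {V : Type*} [Fintype V] (G : SimpleGraph V) : ℝ :=
  sSup (spectrum ℝ (G.lapMatrix ℝ))

open Classical in
/-- On a nonempty graph the supremum above is attained: it is the largest eigenvalue. -/
theorem isGreatest_lapSpectralRadius {V : Type*} [Fintype V] [Nonempty V] (G : SimpleGraph V) :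
    IsGreatest (spectrum ℝ (G.lapMatrix ℝ)) (lapSpectralRadius G) := by
  have h := (G.isHermitian_lapMatrix ℝ).spectrum_real_eq_range_eigenvalues
  have hf : (spectrum ℝ (G.lapMatrix ℝ)).Finite := by
    rw [h]; exact Set.finite_range _
  have hn : (spectrum ℝ (G.lapMatrix ℝ)).Nonempty := by
    rw [h]; exact Set.range_nonempty _
  exact ⟨hn.csSup_mem hf, fun x hx => le_csSup hf.bddAbove hx⟩

/-!
The proof compares the Laplacian `D - A` with the signless Laplacian `D + A`. Write
`g u = ∑_{w ∼ u} (x u + x w)` for the value at `u` of `D + A` applied to a vector `x`.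

* If `x > 0` and `g ≤ c x`, then every eigenvalue of `D - A` is at most `c`
  (`lapSpectralRadius_le_of_weight`): compare an eigenvector with `x` at the vertex where the ratio
  of their absolute values is largest.
* If the graph has a proper sign function `s`, then `D - A` sends `s x` to `s g`, so that
  `∑ x u * g u` is a Rayleigh numerator of `D - A`
  (`sum_mul_signless_le_lapSpectralRadius_mul`).

On the infinite tree `T_{1,∞,∞}` there is a positive square-summable solution of `g = (2 + ε) x`:
it is `1` at the centre, `t ^ k` at distance `k` from the centre along a long arm, where
`t + 1 / t = ε` and `t < 1`, and `1 / (1 + ε)` at the leaf of the short arm. The equation at the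
centre, `3 + 2 t + 1 / (1 + ε) = 2 + ε`, amounts to `ε ^ 3 - 4 ε - 4 = 0` after elimination of `t`.
Cutting the long arms at length `n` makes `g` smaller, and only at the two ends, by `t ^ n (1 + t)`.
Hence `2 + ε - 4 (n + 1) t ^ (2 n) ≤ μ(T_{1,n,n}) ≤ 2 + ε` for `n ≥ 1`, since
the Rayleigh numerator loses at most `2 t ^ (2 n)` at each of the `2 n + 2` vertices (a crude count,
as only two of them matter) and the squared norm of `x` is at least `1`.
-/

/-! ### Bounds for the Laplacian spectral radius -/

open Classical in
theorem lapMatrix_mulVec_eq_sum_sub {V : Type*} [Fintype V] (G : SimpleGraph V) (f : V → ℝ)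
    (u : V) :
    (G.lapMatrix ℝ).mulVec f u = ∑ w, if G.Adj u w then f u - f w else 0 := by
  rw [SimpleGraph.lapMatrix_mulVec_apply, ← Finset.sum_filter, Finset.sum_sub_distrib,
    ← SimpleGraph.neighborFinset_eq_filter, Finset.sum_const,
    SimpleGraph.card_neighborFinset_eq_degree, nsmul_eq_mul]

open Classical in
/-- A Perron-type bound: a positive supersolution of the signless Laplacian bounds the spectrum of
the Laplacian. -/
theorem lapSpectralRadius_le_of_weight {V : Type*} [Fintype V] [Nonempty V] (G : SimpleGraph V)
    (x : V → ℝ) (c : ℝ) (hx : ∀ u, 0 < x u)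
    (h : ∀ u, (∑ w, if G.Adj u w then x u + x w else 0) ≤ c * x u) :
    lapSpectralRadius G ≤ c := by
  have hmem := (isGreatest_lapSpectralRadius G).1
  set μ := lapSpectralRadius G
  obtain ⟨v, hv0, hv⟩ : ∃ v : V → ℝ, v ≠ 0 ∧ (G.lapMatrix ℝ).mulVec v = μ • v := by
    rw [spectrum.mem_iff, Matrix.isUnit_iff_isUnit_det, isUnit_iff_ne_zero, not_not,
      ← Matrix.exists_mulVec_eq_zero_iff] at hmem
    obtain ⟨v, hv0, hv⟩ := hmem
    refine ⟨v, hv0, ?_⟩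
    rw [Matrix.sub_mulVec, Algebra.algebraMap_eq_smul_one, Matrix.smul_mulVec,
      Matrix.one_mulVec, sub_eq_zero] at hv
    exact hv.symm
  obtain ⟨u, hu⟩ := Finite.exists_max fun u => |v u| / x u
  set r := |v u| / x u
  have hle : ∀ w, |v w| ≤ r * x w := fun w => (div_le_iff₀ (hx w)).1 (hu w)
  have heq : |v u| = r * x u := (div_mul_cancel₀ _ (hx u).ne').symm
  have hr : 0 < r := by
    obtain ⟨w, hw⟩ := Function.ne_iff.1 hv0
    exact (div_pos (abs_pos.2 hw) (hx w)).trans_le (hu w)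
  have key : μ * v u = ∑ w, if G.Adj u w then v u - v w else 0 := by
    rw [← lapMatrix_mulVec_eq_sum_sub, hv, Pi.smul_apply, smul_eq_mul]
  have : μ * (r * x u) ≤ c * (r * x u) :=
    calc μ * (r * x u) ≤ |μ * v u| := by
          rw [abs_mul, heq]
          exact mul_le_mul_of_nonneg_right (le_abs_self μ) (heq ▸ abs_nonneg _)
      _ ≤ ∑ w, |if G.Adj u w then v u - v w else 0| := key ▸ Finset.abs_sum_le_sum_abs _ _
      _ ≤ ∑ w, r * (if G.Adj u w then x u + x w else 0) := by
          refine Finset.sum_le_sum fun w _ => ?_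
          split_ifs
          · linarith [abs_sub (v u) (v w), hle u, hle w]
          · simp
      _ ≤ r * (c * x u) := by
          rw [← Finset.mul_sum]
          exact mul_le_mul_of_nonneg_left (h u) hr.le
      _ = c * (r * x u) := by ring
  exact le_of_mul_le_mul_right this (mul_pos hr (hx u))

open Classical in
theorem dotProduct_lapMatrix_mulVec_le {V : Type*} [Fintype V] [Nonempty V] (G : SimpleGraph V)
    (f : V → ℝ) :
    f ⬝ᵥ (G.lapMatrix ℝ).mulVec f ≤ lapSpectralRadius G * f ⬝ᵥ f := by
  have hps : (algebraMap ℝ (Matrix V V ℝ) (lapSpectralRadius G) - G.lapMatrix ℝ).PosSemidef := by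
    rw [Matrix.posSemidef_iff_isHermitian_and_spectrum_nonneg]
    constructor
    · refine Matrix.IsHermitian.sub ?_ (G.isHermitian_lapMatrix ℝ)
      rw [Matrix.algebraMap_eq_diagonal]
      exact Matrix.isHermitian_diagonal _
    · rw [← spectrum.singleton_sub_eq]
      rintro _ ⟨_, rfl, y, hy, rfl⟩
      exact sub_nonneg.2 ((isGreatest_lapSpectralRadius G).2 hy)
  have := hps.dotProduct_mulVec_nonneg f
  rw [Matrix.sub_mulVec, Algebra.algebraMap_eq_smul_one, Matrix.smul_mulVec,
    Matrix.one_mulVec, dotProduct_sub, dotProduct_smul, smul_eq_mul, star_trivial] at this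
  linarith

open Classical in
/-- The Rayleigh bound for a graph with a proper sign function `s`, applied to `s * x`:
multiplication by `s` turns the signless Laplacian into the Laplacian. -/
theorem sum_mul_signless_le_lapSpectralRadius_mul {V : Type*} [Fintype V] [Nonempty V]
    (G : SimpleGraph V) (s : V → ℝ) (hs : ∀ u, s u * s u = 1)
    (hadj : ∀ u w, G.Adj u w → s w = -s u) (x : V → ℝ) :
    ∑ u, x u * (∑ w, if G.Adj u w then x u + x w else 0) ≤
      lapSpectralRadius G * ∑ u, x u * x u := by
  have h := dotProduct_lapMatrix_mulVec_le G (fun u => s u * x u)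
  simp only [dotProduct, lapMatrix_mulVec_eq_sum_sub] at h
  convert h using 1
  · refine Finset.sum_congr rfl fun u _ => ?_
    have : ∀ w, (if G.Adj u w then s u * x u - s w * x w else 0) =
        s u * (if G.Adj u w then x u + x w else 0) := by
      intro w
      split_ifs with huw
      · rw [hadj u w huw]; ring
      · simp
    simp only [this, ← Finset.mul_sum]
    linear_combination (-(x u * ∑ w, if G.Adj u w then x u + x w else 0)) * hs u
  · congr 1
    refine Finset.sum_congr rfl fun u _ => ?_
    linear_combination (-(x u * x u)) * hs u

/-! ### Neighbours in a starlike tree -/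

/-- The function on the vertices of `T_{l,m,n}` with value `c` at the centre and `a i j` at vertex
number `j` of the `i`-th arm. -/
def armFun {l m n : ℕ} (c : ℝ) (a : Fin 3 → ℕ → ℝ) : TVertex l m n → ℝ
  | none => c
  | some ⟨i, j⟩ => a i j

theorem tGraph_adj_none_some {l m n : ℕ} (i : Fin 3) (j : Fin (![l, m, n] i)) :
    (TGraph l m n).Adj none (some ⟨i, j⟩) ↔ (j : ℕ) = 0 := by
  simp [TGraph, SimpleGraph.fromRel_adj, TNext]

theorem tGraph_adj_some_some {l m n : ℕ} (i i' : Fin 3) (j : Fin (![l, m, n] i))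
    (j' : Fin (![l, m, n] i')) :
    (TGraph l m n).Adj (some ⟨i, j⟩) (some ⟨i', j'⟩) ↔
      i' = i ∧ ((j' : ℕ) = j + 1 ∨ (j : ℕ) = j' + 1) := by
  simp only [TGraph, SimpleGraph.fromRel_adj, TNext]
  constructor
  · rintro ⟨-, ⟨h, h'⟩ | ⟨h, h'⟩⟩
    · exact ⟨h.symm, .inl h'⟩
    · exact ⟨h, .inr h'⟩
  · rintro ⟨rfl, h⟩
    refine ⟨?_, h.imp (⟨rfl, ·⟩) (⟨rfl, ·⟩)⟩
    rintro heq
    simp only [Option.some.injEq, Sigma.mk.injEq, heq_eq_eq, true_and] at heq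
    subst heq
    omega

theorem sum_fin_ite_eq (N k : ℕ) (b : ℕ → ℝ) :
    (∑ j : Fin N, if (j : ℕ) = k then b j else 0) = if k < N then b k else 0 := by
  rw [Fin.sum_univ_eq_sum_range (fun j => if j = k then b j else 0), Finset.sum_ite_eq']
  simp

open Classical in
theorem sum_adj_centre {l m n : ℕ} (c : ℝ) (a : Fin 3 → ℕ → ℝ) :
    (∑ w, if (TGraph l m n).Adj none w then armFun c a w else 0) =
      ∑ i, if 0 < ![l, m, n] i then a i 0 else 0 := by
  rw [Fintype.sum_option, Fintype.sum_sigma]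
  simp only [SimpleGraph.irrefl, if_false, zero_add, tGraph_adj_none_some, armFun]
  exact Finset.sum_congr rfl fun i _ => sum_fin_ite_eq _ 0 (a i)

open Classical in
theorem sum_adj_arm {l m n : ℕ} (c : ℝ) (a : Fin 3 → ℕ → ℝ) (i : Fin 3)
    (j : Fin (![l, m, n] i)) :
    (∑ w, if (TGraph l m n).Adj (some ⟨i, j⟩) w then armFun c a w else 0) =
      (if (j : ℕ) = 0 then c else a i (j - 1)) +
        if (j : ℕ) + 1 < ![l, m, n] i then a i (j + 1) else 0 := by
  rw [Fintype.sum_option, Fintype.sum_sigma, Finset.sum_eq_single i]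
  · simp only [SimpleGraph.adj_comm _ _ none, tGraph_adj_none_some, tGraph_adj_some_some, armFun,
      true_and]
    have hj := j.2
    have hsplit : ∀ j' : Fin (![l, m, n] i),
        (if (j' : ℕ) = j + 1 ∨ (j : ℕ) = j' + 1 then a i j' else 0) =
          (if (j' : ℕ) = j + 1 then a i j' else 0) +
            if (j : ℕ) = 0 then 0 else if (j' : ℕ) = j - 1 then a i j' else 0 := by
      intro j'
      split_ifs <;> first | omega | simp
    rw [Finset.sum_congr rfl fun j' _ => hsplit j', Finset.sum_add_distrib, sum_fin_ite_eq]
    by_cases h0 : (j : ℕ) = 0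
    · simp [h0]
    · simp only [h0, if_false, sum_fin_ite_eq]
      rw [if_pos (show (j : ℕ) - 1 < ![l, m, n] i by omega)]
      ring
  · intro i' _ hi'
    simp [tGraph_adj_some_some, hi']
  · simp

/-- The parity of the distance from the centre is a proper sign function. -/
theorem tGraph_alternating {l m n : ℕ} (u w : TVertex l m n) (h : (TGraph l m n).Adj u w) :
    armFun 1 (fun _ j => (-1) ^ (j + 1)) w = -armFun 1 (fun _ j => (-1) ^ (j + 1)) u := by
  match u, w with
  | none, none => exact absurd h (SimpleGraph.irrefl _)
  | none, some ⟨i, j⟩ =>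
    rw [tGraph_adj_none_some] at h
    simp [armFun, h]
  | some ⟨i, j⟩, none =>
    rw [SimpleGraph.adj_comm, tGraph_adj_none_some] at h
    simp [armFun, h]
  | some ⟨i, j⟩, some ⟨i', j'⟩ =>
    obtain ⟨-, h | h⟩ := (tGraph_adj_some_some _ _ _ _).1 h <;> simp [armFun, h, pow_succ]

/-! ### The decaying solution -/

/-- The restriction to `T_{1,n,n}` of the solution on the infinite tree: `1` at the centre, `p` at
the leaf of the short arm, and `t ^ k` at distance `k` from the centre on a long arm. -/
def decayFun (t p : ℝ) (n : ℕ) : TVertex 1 n n → ℝ :=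
  armFun 1 ![fun _ => p, fun j => t ^ (j + 1), fun j => t ^ (j + 1)]

open Classical in
/-- The signless Laplacian at `u` of a function, split into degree and neighbour sum. -/
theorem sum_adj_add_eq {V : Type*} [Fintype V] (G : SimpleGraph V) (x : V → ℝ) (u : V) :
    (∑ w, if G.Adj u w then x u + x w else 0) =
      x u * (∑ w, if G.Adj u w then 1 else 0) + ∑ w, if G.Adj u w then x w else 0 := by
  rw [Finset.mul_sum, ← Finset.sum_add_distrib]
  refine Finset.sum_congr rfl fun w _ => ?_
  split_ifs <;> simp

theorem armFun_one {l m n : ℕ} : (armFun 1 fun _ _ => 1 : TVertex l m n → ℝ) = fun _ => 1 := by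
  funext u
  match u with
  | none => rfl
  | some ⟨_, _⟩ => rfl

open Classical in
/-- The defect `t ^ n * (1 + t)` at the two ends of the long arms, where `decayFun` is `t ^ n`, is
its only deviation from a solution of `(D + A) x = (2 + ε) x`. -/
theorem signless_decayFun {ε t p : ℝ} (ht : t ^ 2 - ε * t + 1 = 0)
    (hp : p * (1 + ε) = 1) (hc : 3 + 2 * t + p = 2 + ε) {n : ℕ} (hn : 1 ≤ n)
    (u : TVertex 1 n n) :
    (∑ w, if (TGraph 1 n n).Adj u w then decayFun t p n u + decayFun t p n w else 0) =
        (2 + ε) * decayFun t p n u ∨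
      decayFun t p n u = t ^ n ∧
      (∑ w, if (TGraph 1 n n).Adj u w then decayFun t p n u + decayFun t p n w else 0) =
        (2 + ε) * decayFun t p n u - t ^ n * (1 + t) := by
  have hone : (∑ w, if (TGraph 1 n n).Adj u w then (1 : ℝ) else 0) =
      ∑ w, if (TGraph 1 n n).Adj u w then armFun 1 (fun _ _ => 1) w else 0 := by
    simp only [armFun_one]
  -- On a long arm, in the form in which `sum_adj_arm` gives it: once for the constant function `1`,
  -- which counts the neighbours, and once for `decayFun`.
  have hlong : ∀ j, j < n →
      (t ^ (j + 1) * ((if j = 0 then 1 else 1) + if j + 1 < n then 1 else 0) +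
        ((if j = 0 then 1 else t ^ (j - 1 + 1)) + if j + 1 < n then t ^ (j + 1 + 1) else 0) =
          (2 + ε) * t ^ (j + 1)) ∨ t ^ (j + 1) = t ^ n ∧
      (t ^ (j + 1) * ((if j = 0 then 1 else 1) + if j + 1 < n then 1 else 0) +
        ((if j = 0 then 1 else t ^ (j - 1 + 1)) + if j + 1 < n then t ^ (j + 1 + 1) else 0) =
          (2 + ε) * t ^ (j + 1) - t ^ n * (1 + t)) := by
    intro j hj
    have h1 : (if j = 0 then 1 else t ^ (j - 1 + 1)) = t ^ j := by
      rcases j with _ | j <;> simp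
    rw [h1, ite_self]
    by_cases hjn : j + 1 < n
    · left
      rw [if_pos hjn, if_pos hjn]
      linear_combination t ^ j * ht
    · right
      obtain rfl : n = j + 1 := by omega
      refine ⟨rfl, ?_⟩
      rw [if_neg hjn, if_neg hjn]
      linear_combination t ^ j * ht
  rw [sum_adj_add_eq, hone]
  clear hone
  match u with
  | none =>
    left
    simp only [decayFun, sum_adj_centre, Fin.sum_univ_three]
    simp [armFun, show 0 < n from hn]
    linear_combination hc
  | some ⟨i, j⟩ =>
    simp only [decayFun, sum_adj_arm]
    match i, j with
    | 0, j =>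
      left
      have hj : (j : ℕ) = 0 := by have := j.2; simp at this ; omega
      simp [armFun, hj]
      linear_combination -hp
    | 1, j => exact hlong j j.2
    | 2, j => exact hlong j j.2

theorem decayFun_pos {t p : ℝ} (ht : 0 < t) (hp : 0 < p) (n : ℕ) (u : TVertex 1 n n) :
    0 < decayFun t p n u := by
  match u with
  | none => exact one_pos
  | some ⟨0, _⟩ => exact hp
  | some ⟨1, j⟩ => exact pow_pos ht _
  | some ⟨2, j⟩ => exact pow_pos ht _

theorem lapSpectralRadius_tGraph_le {ε t p : ℝ} (ht : t ^ 2 - ε * t + 1 = 0)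
    (hp : p * (1 + ε) = 1) (hc : 3 + 2 * t + p = 2 + ε) (ht0 : 0 < t) (hp0 : 0 < p) {n : ℕ}
    (hn : 1 ≤ n) : lapSpectralRadius (TGraph 1 n n) ≤ 2 + ε := by
  refine lapSpectralRadius_le_of_weight _ (decayFun t p n) _ (decayFun_pos ht0 hp0 n) fun u => ?_
  rcases signless_decayFun ht hp hc hn u with h | ⟨-, h⟩
  · exact h.le
  · rw [h]
    have : 0 < t ^ n * (1 + t) := by positivity
    linarith

theorem le_lapSpectralRadius_tGraph {ε t p : ℝ} (ht : t ^ 2 - ε * t + 1 = 0)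
    (hp : p * (1 + ε) = 1) (hc : 3 + 2 * t + p = 2 + ε) (ht0 : 0 < t) (ht1 : t < 1) {n : ℕ}
    (hn : 1 ≤ n) :
    2 + ε - 4 * ((n + 1) * (t ^ 2) ^ n) ≤ lapSpectralRadius (TGraph 1 n n) := by
  classical
  set x := decayFun t p n with hx
  have hray := sum_mul_signless_le_lapSpectralRadius_mul (TGraph 1 n n)
    (armFun 1 fun _ j => (-1) ^ (j + 1))
    (by rintro (_ | ⟨i, j⟩) <;> simp [armFun, ← mul_pow]) tGraph_alternating x
  have hterm : ∀ u, (2 + ε) * (x u * x u) - 2 * (t ^ 2) ^ n ≤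
      x u * ∑ w, if (TGraph 1 n n).Adj u w then x u + x w else 0 := by
    intro u
    rcases signless_decayFun ht hp hc hn u with h | ⟨h', h⟩
    · rw [h, ← hx]
      have : 0 < (t ^ 2) ^ n := by positivity
      linarith
    · rw [h, ← hx, show x u = t ^ n from h', ← pow_mul, mul_comm 2 n, pow_mul]
      nlinarith [mul_nonneg (sq_nonneg (t ^ n)) (sub_nonneg.2 ht1.le)]
  have hsum := (Finset.sum_le_sum fun u (_ : u ∈ Finset.univ) => hterm u).trans hray
  have hcard : Fintype.card (TVertex 1 n n) = 2 * n + 2 := by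
    simp [Fin.sum_univ_three]
    ring
  rw [Finset.sum_sub_distrib, ← Finset.mul_sum, Finset.sum_const, Finset.card_univ, hcard,
    nsmul_eq_mul] at hsum
  push_cast at hsum
  -- The centre alone contributes `1` to the squared norm.
  have hS : 1 ≤ ∑ u, x u * x u := by
    have := Finset.single_le_sum (f := fun u => x u * x u) (fun u _ => mul_self_nonneg (x u))
      (Finset.mem_univ none)
    simpa [hx, decayFun, armFun] using this
  have hE : 0 ≤ 4 * ((n + 1) * (t ^ 2) ^ n) := by positivity
  refine le_of_mul_le_mul_right (a := ∑ u, x u * x u) ?_ (by linarith)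
  nlinarith [mul_le_mul_of_nonneg_left hS hE]

/-! ### The cubic -/

theorem existsUnique_root_cubic :
    ∃ ε : ℝ, (2.3829757676 < ε ∧ ε < 2.3829757680) ∧ ∀ x : ℝ, x ^ 3 - 4 * x - 4 = 0 ↔ x = ε := by
  obtain ⟨ε, hε, h0⟩ : (0 : ℝ) ∈ (fun x : ℝ => x ^ 3 - 4 * x - 4) ''
      Set.Ioo 2.3829757676 2.3829757680 :=
    intermediate_value_Ioo (by norm_num) (by fun_prop) (by constructor <;> norm_num)
  refine ⟨ε, hε, fun x => ⟨fun hx => ?_, fun hx => hx ▸ h0⟩⟩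
  have h0 : ε ^ 3 - 4 * ε - 4 = 0 := h0
  have hmul : (x - ε) * (x ^ 2 + x * ε + ε ^ 2 - 4) = 0 := by linear_combination hx - h0
  -- The quadratic factor has discriminant `16 - 3 * ε ^ 2 < 0`.
  have hq : 0 < x ^ 2 + x * ε + ε ^ 2 - 4 := by
    nlinarith [sq_nonneg (x + ε / 2), hε.1]
  exact sub_eq_zero.1 ((mul_eq_zero.1 hmul).resolve_right hq.ne')

theorem mainTheorem3 :
    ∃ ε : ℝ, (∀ x : ℝ, x ^ 3 - 4 * x - 4 = 0 ↔ x = ε) ∧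
      |(2 + ε) - 4.382975767| < 1 / 10 ^ 9 ∧
      Filter.Tendsto (fun n : ℕ => lapSpectralRadius (TGraph 1 n n)) Filter.atTop
        (nhds (2 + ε)) := by
  obtain ⟨ε, ⟨hl, hu⟩, hroot⟩ := existsUnique_root_cubic
  refine ⟨ε, hroot, by rw [abs_lt]; constructor <;> norm_num <;> linarith, ?_⟩
  have h0 : ε ^ 3 - 4 * ε - 4 = 0 := (hroot ε).2 rfl
  have h1 : 0 < 1 + ε := by linarith
  -- The equations at the centre and at the short leaf determine `p` and `t`; the cubic is then
  -- the recurrence `t ^ 2 - ε * t + 1 = 0` along the long arms.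
  obtain ⟨p, hp⟩ : ∃ p, p * (1 + ε) = 1 := ⟨(1 + ε)⁻¹, inv_mul_cancel₀ h1.ne'⟩
  obtain ⟨t, hc⟩ : ∃ t, 3 + 2 * t + p = 2 + ε := ⟨(ε - 1 - p) / 2, by ring⟩
  have hp0 : 0 < p := pos_of_mul_pos_left (hp.symm ▸ one_pos : 0 < p * (1 + ε)) h1.le
  have hp1 : p < 1 / 3 := by nlinarith
  have ht0 : 0 < t := by linarith
  have ht1 : t < 1 := by linarith
  have ht : t ^ 2 - ε * t + 1 = 0 := by
    have h2 : 2 * t * (1 + ε) = ε ^ 2 - 2 := by linear_combination (1 + ε) * hc - hp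
    have h3 : 4 * (1 + ε) ^ 2 * (t ^ 2 - ε * t + 1) = 0 := by
      linear_combination (2 * t * (1 + ε) + ε ^ 2 - 2 - 2 * ε * (1 + ε)) * h2 - (ε + 2) * h0
    exact (mul_eq_zero.1 h3).resolve_left (by positivity)
  have hlim : Filter.Tendsto (fun n : ℕ => 2 + ε - 4 * (((n : ℝ) + 1) * (t ^ 2) ^ n))
      Filter.atTop (nhds (2 + ε)) := by
    have hsq0 : 0 ≤ t ^ 2 := sq_nonneg t
    have hsq1 : t ^ 2 < 1 := by nlinarith
    have := (((tendsto_self_mul_const_pow_of_lt_one hsq0 hsq1).add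
      (tendsto_pow_atTop_nhds_zero_of_lt_one hsq0 hsq1)).const_mul 4).const_sub (2 + ε)
    simpa [add_mul] using this
  refine tendsto_of_tendsto_of_tendsto_of_le_of_le' hlim tendsto_const_nhds ?_ ?_
  · filter_upwards [Filter.eventually_ge_atTop 1] with n hn
    exact le_lapSpectralRadius_tGraph ht hp hc ht0 ht1 hn
  · filter_upwards [Filter.eventually_ge_atTop 1] with n hn
    exact lapSpectralRadius_tGraph_le ht hp hc ht0 hp0 hn
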